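/- Let $M$ be a $C^\infty$ manifold of dimension $2n$ and let $S\in\Gamma\,\mathrm{End}(TM)$ be a tangent structure: $S^2=0$, $\operatorname{im}S=\ker S$, and around every point there are (adapted) coordinates $(x^i,y^i)_{i=1}^n$ with $S(\partial/\partial x^i)=\partial/\partial y^i$, $S(\partial/\partial y^i)=0$. Put $T\mathcal V=\operatorname{im}S$. Let $E$ be an Euler vector field, i.e. a vector field tangent to $T\mathcal V$ which, in adapted coordinates around each point, has the form $E=\sum_i (y^i+q^i)\,\partial/\partial y^i$ with functions $q^i$ annihilated by all vertical vectors. Let $TM=N\mathcal V\oplus T\mathcal V$ be a normalization (a smooth complementary, "horizontal", distribution), with projections $p_N,p_T$, and let $S'$ be the tensor field that is $0$ on $N\mathcal V$ and $(S|_{N\mathcal V})^{-1}$ on $T\mathcal V$. Let $\gamma$ be a compatible pseudo-Riemannian metric: $N\mathcal V\perp T\mathcal V$ and $\gamma(SX,SY)=\gamma(X,Y)$ for $X,Y\in\Gamma N\mathcal V$. Let $\nabla$ be the Levi-Civita connection of $\gamma$ and $D$ the canonical connection, given for $Z_1,Z_2\in\Gamma N\mathcal V$, $Y_1,Y_2\in\Gamma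 T\mathcal V$ by $$D_{Z_1}Z_2=p_N\nabla_{Z_1}Z_2,\quad D_{Y_1}Y_2=p_T\nabla_{Y_1}Y_2,\quad D_{Y_1}Z_2=p_N[Y_1,Z_2],\quad D_{Z_1}Y_2=p_T[Z_1,Y_2],$$ with curvature $R_D(X,Y)Z=D_XD_YZ-D_YD_XZ-D_{[X,Y]}Z$. Then the curvature operators $R_D(X,Y)|_{N\mathcal V}$, $X,Y\in\Gamma N\mathcal V$, are determined, locally and by an explicit formula in the connection $D$, by their action $r(X,Y)=R_D(X,Y)S'E$ on $S'E$ and by the operators $K(V,W)=R_D(V,SW)|_{N\mathcal V}$, $V,W\in\Gamma N\mathcal V$. Precisely, let $U\subseteq M$ be open and let $r$, $K$ be operations, with vector fields on $M$ as arguments and values, such that $r(X,Y)=R_D(X,Y)S'E$ and $K(V,W)Z=R_D(V,SW)Z$ on $U$ for all $X,Y,V,W,Z\in\Gamma N\mathcal V$. Then, for all $X,Y,Z\in\Gamma N\mathcal V$, on $U$, $$R_D(X,Y)Z=(D_{SZ}r)(X,Y)+(D_XK)(Y,Z)S'E-(D_YK)(X,Z)S'E,$$ where $$(D_Ar)(X,Y)=D_A(r(X,Y))-r(D_AX,Y)-r(X,D_AY),$$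 $$(D_AK)(V,W)Z=D_A(K(V,W)Z)-K(D_AV,W)Z-K(V,S'D_A(SW))Z-K(V,W)D_AZ .$$ -/

import Mathlib

open Bundle VectorField
open scoped Manifold ContDiff

noncomputable section

namespace TangentMfd

/-- The model `ℝⁿ × ℝⁿ` of a `2n`-dimensional manifold; a chart with values in it is a system of
coordinates `(x, y)`, `x = (x¹, …, xⁿ)`, `y = (y¹, …, yⁿ)`. -/
abbrev Model (n : ℕ) : Type := EuclideanSpace ℝ (Fin n) × EuclideanSpace ℝ (Fin n)

variable {n : ℕ} {M : Type*} [TopologicalSpace M] [ChartedSpace (Model n) M]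

variable (n M) in
/-- (Not necessarily smooth) vector fields on `M`. -/
abbrev VField : Type _ := (p : M) → TangentSpace 𝓘(ℝ, Model n) p

variable (n M) in
/-- (Not necessarily smooth) fields of endomorphisms of the tangent spaces of `M`. -/
abbrev EndField : Type _ :=
  (p : M) → TangentSpace 𝓘(ℝ, Model n) p →L[ℝ] TangentSpace 𝓘(ℝ, Model n) p

variable (n M) in
/-- (Not necessarily smooth) fields of bilinear forms on the tangent spaces of `M`. -/
abbrev BilinField : Type _ :=
  (p : M) → TangentSpace 𝓘(ℝ, Model n) p →L[ℝ] TangentSpace 𝓘(ℝ, Model n) p →L[ℝ] ℝ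

/-- The vector field `X` is `C^∞`. -/
def SmoothVField [IsManifold 𝓘(ℝ, Model n) ∞ M] (X : VField n M) : Prop :=
  ContMDiff 𝓘(ℝ, Model n) (𝓘(ℝ, Model n).prod 𝓘(ℝ, Model n)) ∞
    (fun p => TotalSpace.mk' (Model n) (E := fun p : M => TangentSpace 𝓘(ℝ, Model n) p) p (X p))

/-- The field of endomorphisms `A` is `C^∞`. -/
def SmoothEndField [IsManifold 𝓘(ℝ, Model n) ∞ M] (A : EndField n M) : Prop :=
  ContMDiff 𝓘(ℝ, Model n) (𝓘(ℝ, Model n).prod 𝓘(ℝ, Model n →L[ℝ] Model n)) ∞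
    (fun p => TotalSpace.mk' (Model n →L[ℝ] Model n)
      (E := fun p : M => TangentSpace 𝓘(ℝ, Model n) p →L[ℝ] TangentSpace 𝓘(ℝ, Model n) p) p (A p))

/-- The field of bilinear forms `γ` is `C^∞`. -/
def SmoothBilinField [IsManifold 𝓘(ℝ, Model n) ∞ M] (γ : BilinField n M) : Prop :=
  ContMDiff 𝓘(ℝ, Model n) (𝓘(ℝ, Model n).prod 𝓘(ℝ, Model n →L[ℝ] Model n →L[ℝ] ℝ)) ∞
    (fun p => TotalSpace.mk' (Model n →L[ℝ] Model n →L[ℝ] ℝ)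
      (E := fun p : M =>
        TangentSpace 𝓘(ℝ, Model n) p →L[ℝ] TangentSpace 𝓘(ℝ, Model n) p →L[ℝ] ℝ) p (γ p))

/-- Pointwise application of a field of endomorphisms to a vector field. -/
def app (A : EndField n M) (X : VField n M) : VField n M := fun p => A p (X p)

/-! ### Bundle-type tangent manifolds -/

/-- `e` is a `C^∞` chart with coordinates `(x, y)` in which `S(∂/∂xⁱ) = ∂/∂yⁱ`,
`S(∂/∂yⁱ) = 0`. -/
def IsAdaptedChart (S : EndField n M) (e : OpenPartialHomeomorph M (Model n)) : Prop :=
  e ∈ IsManifold.maximalAtlas 𝓘(ℝ, Model n) ∞ M ∧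
    ∀ p ∈ e.source, ∀ v : TangentSpace 𝓘(ℝ, Model n) p,
      mvfderiv 𝓘(ℝ, Model n) e p (S p v) = (0, (mvfderiv 𝓘(ℝ, Model n) e p v).1)

/-- `S` is a tangent structure: a smooth field of endomorphisms with `S² = 0` and `im S = ker S`
which is integrable, i.e., the charts adapted to `S` cover `M`. The vertical distribution
`T𝒱` is `im S`. -/
structure IsTangentStructure [IsManifold 𝓘(ℝ, Model n) ∞ M] (S : EndField n M) : Prop where
  smooth : SmoothEndField S
  sq_eq_zero : ∀ p v, S p (S p v) = 0
  range_eq_ker : ∀ p, (S p).toLinearMap.range = (S p).toLinearMap.ker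
  integrable : ∀ p, ∃ e, IsAdaptedChart S e ∧ p ∈ e.source

/-- `E` is an Euler vector field of the tangent structure `S`: it is smooth, tangent to the leaves
of the vertical foliation and, in adapted coordinates `(x, y)` around each point, it is
`yⁱ ∂/∂yⁱ + qⁱ ∂/∂yⁱ`, where the functions `qⁱ` are foliated (annihilated by all the vertical
vectors). -/
structure IsEulerField [IsManifold 𝓘(ℝ, Model n) ∞ M] (S : EndField n M) (E : VField n M) : Prop where
  smooth : SmoothVField E
  vertical : ∀ p, ∃ v, S p v = E p
  euler : ∀ p, ∃ e, IsAdaptedChart S e ∧ p ∈ e.source ∧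
    ∀ m ∈ e.source, ∀ v : TangentSpace 𝓘(ℝ, Model n) m,
      mvfderiv 𝓘(ℝ, Model n)
        (fun m' : M => (mvfderiv 𝓘(ℝ, Model n) e m' (E m')).2 - (e m').2) m (S m v) = 0

/-! ### Normalizations -/

/-- A normalization `TM = N𝒱 ⊕ T𝒱` of `(M, S)`, given by its projector `pN` onto the horizontal
bundle `N𝒱 = im pN` along `T𝒱 = im S`. -/
structure IsNormalization [IsManifold 𝓘(ℝ, Model n) ∞ M] (S pN : EndField n M) : Prop where
  smooth : SmoothEndField pN
  idem : ∀ p v, pN p (pN p v) = pN p v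
  ker_eq : ∀ p, (pN p).toLinearMap.ker = (S p).toLinearMap.range

/-- The projector onto `T𝒱` along `N𝒱`. -/
def vertProj (pN : EndField n M) : EndField n M := fun p => ContinuousLinearMap.id ℝ _ - pN p

/-- `X ∈ Γ N𝒱`: a smooth vector field with values in the horizontal bundle `N𝒱 = im pN`. -/
def IsHorizontal [IsManifold 𝓘(ℝ, Model n) ∞ M] (pN : EndField n M) (X : VField n M) : Prop :=
  SmoothVField X ∧ ∀ p, pN p (X p) = X p

/-- The tensor `S' = 0 ⊕ Q⁻¹`, where `Q : N𝒱 → T𝒱` is the isomorphism induced by `S`: the vector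
`S' v` is the horizontal part of any `w` such that `S w` is the vertical part of `v`. -/
def sPrime (S pN : EndField n M) (X : VField n M) : VField n M := fun p =>
  pN p (Classical.epsilon fun w => S p w = vertProj pN p (X p))

/-- `S' X` is the only horizontal field whose image by `S` is the vertical part of `X`. -/
theorem sPrime_apply_eq_iff [IsManifold 𝓘(ℝ, Model n) ∞ M] {S pN : EndField n M}
    (hS : IsTangentStructure S) (hN : IsNormalization S pN) (X : VField n M) (p : M)
    (w : TangentSpace 𝓘(ℝ, Model n) p) :
    sPrime S pN X p = w ↔ pN p w = w ∧ S p w = vertProj pN p (X p) := by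
  have hSN : ∀ v, S p (pN p v) = S p v := by
    intro v
    have h1 : v - pN p v ∈ (pN p).toLinearMap.ker := by
      simp [LinearMap.mem_ker, hN.idem]
    rw [hN.ker_eq, hS.range_eq_ker] at h1
    have h2 : S p (v - pN p v) = 0 := h1
    rw [map_sub, sub_eq_zero] at h2
    exact h2.symm
  have hex : ∃ u, S p u = vertProj pN p (X p) := by
    have h1 : vertProj pN p (X p) ∈ (pN p).toLinearMap.ker := by
      simp [vertProj, LinearMap.mem_ker, hN.idem]
    rw [hN.ker_eq] at h1
    exact h1
  have hsp := Classical.epsilon_spec hex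
  constructor
  · rintro rfl
    exact ⟨hN.idem _ _, (hSN _).trans hsp⟩
  · rintro ⟨h1, h2⟩
    have h3 : Classical.epsilon (fun u => S p u = vertProj pN p (X p)) - w
        ∈ (pN p).toLinearMap.ker := by
      rw [hN.ker_eq, hS.range_eq_ker]
      simp [LinearMap.mem_ker, map_sub, hsp, h2]
    have h4 : pN p (Classical.epsilon (fun u => S p u = vertProj pN p (X p)) - w) = 0 := h3
    rw [map_sub, h1, sub_eq_zero] at h4
    exact h4

/-! ### Compatible metrics and their connections -/

/-- `γ` is a pseudo-Riemannian metric compatible with the normalized tangent manifold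
`(M, S, N𝒱)`: `N𝒱 ⟂ T𝒱` and `γ(SX, SY) = γ(X, Y)` for horizontal `X, Y`. -/
structure IsCompatibleMetric [IsManifold 𝓘(ℝ, Model n) ∞ M] (S pN : EndField n M)
    (γ : BilinField n M) : Prop where
  smooth : SmoothBilinField γ
  symm : ∀ p v w, γ p v w = γ p w v
  nondegenerate : ∀ p v, (∀ w, γ p v w = 0) → v = 0
  orthogonal : ∀ p v w, γ p (pN p v) (S p w) = 0
  compatible : ∀ p v w, γ p (S p (pN p v)) (S p (pN p w)) = γ p (pN p v) (pN p w)

/-- `nab` is the Levi-Civita connection of the pseudo-Riemannian metric `γ`: the smooth linear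
connection on `TM` without torsion for which `γ` is parallel. Here `nab Y p v` is the covariant
derivative of `Y` in the direction `v ∈ T_p M`. -/
structure IsLeviCivita [IsManifold 𝓘(ℝ, Model n) ∞ M] (γ : BilinField n M)
    (nab : CovariantDerivative 𝓘(ℝ, Model n) (Model n)
      (fun p : M => TangentSpace 𝓘(ℝ, Model n) p)) : Prop where
  smooth : CovariantDerivative.ContMDiffCovariantDerivative nab ∞
  torsion_eq_zero : nab.torsion = 0
  metric : ∀ (p : M) (v : TangentSpace 𝓘(ℝ, Model n) p) (Y Z : VField n M),
    MDifferentiableAt 𝓘(ℝ, Model n) (𝓘(ℝ, Model n).prod 𝓘(ℝ, Model n))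
      (fun q => TotalSpace.mk' (Model n) (E := fun q : M => TangentSpace 𝓘(ℝ, Model n) q) q (Y q))
      p →
    MDifferentiableAt 𝓘(ℝ, Model n) (𝓘(ℝ, Model n).prod 𝓘(ℝ, Model n))
      (fun q => TotalSpace.mk' (Model n) (E := fun q : M => TangentSpace 𝓘(ℝ, Model n) q) q (Z q))
      p →
    mvfderiv 𝓘(ℝ, Model n) (fun q : M => γ q (Y q) (Z q)) p v
      = γ p (nab Y p v) (Z p) + γ p (Y p) (nab Z p v)

/-- The canonical connection `D_X Y`, `X = Z₁ + Y₁`, `Y = Z₂ + Y₂` with `Zᵢ` horizontal and `Yᵢ`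
vertical, built from the Levi-Civita connection `∇`: `D_{Z₁}Z₂ = p_N ∇_{Z₁}Z₂`,
`D_{Y₁}Y₂ = p_T ∇_{Y₁}Y₂`, `D_{Y₁}Z₂ = p_N [Y₁, Z₂]`, `D_{Z₁}Y₂ = p_T [Z₁, Y₂]`. -/
def canonicalConn [IsManifold 𝓘(ℝ, Model n) ∞ M] (pN : EndField n M)
    (nab : CovariantDerivative 𝓘(ℝ, Model n) (Model n)
      (fun p : M => TangentSpace 𝓘(ℝ, Model n) p)) (X Y : VField n M) : VField n M := fun p =>
  pN p (nab (app pN Y) p (app pN X p))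
    + vertProj pN p (nab (app (vertProj pN) Y) p (app (vertProj pN) X p))
    + pN p (mlieBracket 𝓘(ℝ, Model n) (app (vertProj pN) X) (app pN Y) p)
    + vertProj pN p (mlieBracket 𝓘(ℝ, Model n) (app pN X) (app (vertProj pN) Y) p)

/-- The curvature `R_D(X, Y)Z = D_X D_Y Z - D_Y D_X Z - D_{[X, Y]} Z` of an operator `D` of
covariant differentiation of vector fields. -/
def curv (D : VField n M → VField n M → VField n M) (X Y Z : VField n M) : VField n M :=
  D X (D Y Z) - D Y (D X Z) - D (mlieBracket 𝓘(ℝ, Model n) X Y) Z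

/-! ### Expressions in terms of `r` and `K` -/

/-- The covariant derivative `(D_A r)(X, Y)` of an operation `r` on two vector fields. -/
def covDeriv₂ (D : VField n M → VField n M → VField n M)
    (r : VField n M → VField n M → VField n M) (A X Y : VField n M) : VField n M :=
  D A (r X Y) - r (D A X) Y - r X (D A Y)

/-- The covariant derivative of an operation `K` on horizontal vector fields, for the connection
`D` where the second argument `W` of `K` stands for the vertical field `SW`, so that it is
differentiated as `S' (D_A (SW))`:
`(D_A K)(V, W)U = D_A(K(V, W)U) - K(D_A V, W)U - K(V, S' D_A (SW))U - K(V, W)(D_A U)`. -/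
def covDeriv₃ (S pN : EndField n M) (D : VField n M → VField n M → VField n M)
    (K : VField n M → VField n M → VField n M → VField n M) (A V W U : VField n M) :
    VField n M :=
  D A (K V W U) - K (D A V) W U - K V (sPrime S pN (D A (app S W))) U - K V W (D A U)

/-- The expression of the horizontal curvature `R_D(X, Y)Z` in terms of `r` (standing for
`R_D(X, Y)S'E`) and `K` (standing for `R_D(V, SW)U`):
`(D_{SZ} r)(X, Y) + (D_X K)(Y, Z)S'E - (D_Y K)(X, Z)S'E`. -/
def curvExpr (S pN : EndField n M) (E : VField n M)
    (D : VField n M → VField n M → VField n M)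
    (r : VField n M → VField n M → VField n M)
    (K : VField n M → VField n M → VField n M → VField n M) (X Y Z : VField n M) : VField n M :=
  covDeriv₂ D r (app S Z) X Y
    + covDeriv₃ S pN D K X Y Z (sPrime S pN E) - covDeriv₃ S pN D K Y X Z (sPrime S pN E)

end TangentMfd

end

set_option linter.unusedSectionVars false

noncomputable section

namespace TangentMfd

open scoped Topology

variable {n : ℕ} {M : Type*} [TopologicalSpace M] [ChartedSpace (Model n) M]
  [IsManifold 𝓘(ℝ, Model n) ∞ M]

/-! ### Vector fields in a chart -/

/-! The key identity is `D_{SZ} S'E = Z` for horizontal `Z`. It turns `R_D(X,Y)Z` into `R_D(X,Y)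
D_{SZ}(S'E)`, which is exactly the term missing from `(D_{SZ} r)(X,Y)` when that is compared with
the full derivative of the curvature applied to `S'E`. The differential Bianchi identity for `X`,
`Y`, `SZ`, applied to `S'E`, isolates this term and expresses it through derivatives of `r` and `K`.

The torsion of `D` leaves no extra term in this formula: it vanishes on a vertical and a horizontal
argument, while on `X`, `Y` it is the vertical field `-p_T[X,Y]`. The latter enters only through
`R_D(p_T[X,Y], SZ)S'E`, which is zero: along the leaves `D` on `N𝒱` is `p_N[V, ·]`, and it is flat
by the Jacobi identity and the integrability of `T𝒱`.

The identity `D_{SZ} S'E = p_N[SZ, S'E] = Z` is a computation in adapted coordinates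
(`IsEulerField.apply_mlieBracket_sPrime`). The rest is carried by `curvature_eq_of_bianchi`,
`canonicalConn_mixed_torsion`, `canonicalConn_horizontal_torsion` and `curv_vertical_vertical`. -/

theorem SmoothVField.mdifferentiableAt {V : VField n M} (hV : SmoothVField V) (p : M) :
    MDifferentiableAt 𝓘(ℝ, Model n) (𝓘(ℝ, Model n).prod 𝓘(ℝ, Model n))
      (fun q => TotalSpace.mk' (Model n) (E := fun q : M => TangentSpace 𝓘(ℝ, Model n) q) q (V q))
      p :=
  (hV p).mdifferentiableAt (by simp)

/-- The expression of the vector field `V` in the chart `e`. -/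
def chartRep (e : OpenPartialHomeomorph M (Model n)) (V : VField n M) : Model n → Model n :=
  fun z => mvfderiv 𝓘(ℝ, Model n) e (e.symm z) (V (e.symm z))

theorem mdifferentiable_of_mem_maximalAtlas {e : OpenPartialHomeomorph M (Model n)}
    (he : e ∈ IsManifold.maximalAtlas 𝓘(ℝ, Model n) ∞ M) :
    e.MDifferentiable 𝓘(ℝ, Model n) 𝓘(ℝ, Model n) :=
  ⟨(contMDiffOn_of_mem_maximalAtlas he).mdifferentiableOn (by simp),
    (contMDiffOn_symm_of_mem_maximalAtlas he).mdifferentiableOn (by simp)⟩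

theorem mvfderiv_chart_injective {e : OpenPartialHomeomorph M (Model n)}
    (he : e ∈ IsManifold.maximalAtlas 𝓘(ℝ, Model n) ∞ M) {p : M} (hp : p ∈ e.source) :
    Function.Injective (mvfderiv 𝓘(ℝ, Model n) e p) :=
  (mdifferentiable_of_mem_maximalAtlas he).mfderiv_injective hp

theorem isInvertible_mfderiv_chart {e : OpenPartialHomeomorph M (Model n)}
    (he : e ∈ IsManifold.maximalAtlas 𝓘(ℝ, Model n) ∞ M) {p : M} (hp : p ∈ e.source) :
    (mfderiv 𝓘(ℝ, Model n) 𝓘(ℝ, Model n) e p).IsInvertible :=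
  ⟨(mdifferentiable_of_mem_maximalAtlas he).mfderiv hp, rfl⟩

theorem inverse_mfderiv_chart_symm {e : OpenPartialHomeomorph M (Model n)}
    (he : e ∈ IsManifold.maximalAtlas 𝓘(ℝ, Model n) ∞ M) {z : Model n} (hz : z ∈ e.target) :
    (mfderiv 𝓘(ℝ, Model n) 𝓘(ℝ, Model n) e.symm z).inverse
      = mfderiv 𝓘(ℝ, Model n) 𝓘(ℝ, Model n) e (e.symm z) := by
  have hd := mdifferentiable_of_mem_maximalAtlas he
  have h1 : mfderiv 𝓘(ℝ, Model n) 𝓘(ℝ, Model n) e.symm z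
      = (hd.symm.mfderiv (x := z) hz : _ →L[ℝ] _) := rfl
  rw [h1, ContinuousLinearMap.inverse_equiv]
  rfl

/-- This makes the smoothness and bracket naturality of `mpullback` available for `chartRep`. The
equality holds on `e.target`, where the derivatives of `e` and `e.symm` are mutually inverse. -/
theorem mpullback_chart_symm_eventuallyEq {e : OpenPartialHomeomorph M (Model n)}
    (he : e ∈ IsManifold.maximalAtlas 𝓘(ℝ, Model n) ∞ M) (V : VField n M) {p : M}
    (hp : p ∈ e.source) :
    mpullback 𝓘(ℝ, Model n) 𝓘(ℝ, Model n) e.symm V =ᶠ[𝓝 (e p)] chartRep e V := by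
  filter_upwards [e.open_target.mem_nhds (e.map_source hp)] with z hz
  rw [mpullback_apply, inverse_mfderiv_chart_symm he hz]
  rfl

theorem contDiffAt_chartRep {e : OpenPartialHomeomorph M (Model n)}
    (he : e ∈ IsManifold.maximalAtlas 𝓘(ℝ, Model n) ∞ M) {V : VField n M}
    (hV : SmoothVField V) {p : M} (hp : p ∈ e.source) :
    ContDiffAt ℝ ∞ (chartRep e V) (e p) := by
  have ht := e.map_source hp
  have h1 := ContMDiffAt.mpullback_vectorField_preimage (m := ∞) (n := ∞)
    (hV (e.symm (e p))) (contMDiffAt_symm_of_mem_maximalAtlas he ht)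
    ⟨(mdifferentiable_of_mem_maximalAtlas he).symm.mfderiv (x := e p) ht, rfl⟩ le_rfl
  have h2 := contMDiffAt_vectorSpace_iff_contDiffAt.1 h1
  exact h2.congr_of_eventuallyEq (mpullback_chart_symm_eventuallyEq he V hp).symm

/-- In a chart, the bracket of vector fields is that of their expressions. -/
theorem mvfderiv_chart_mlieBracket {e : OpenPartialHomeomorph M (Model n)}
    (he : e ∈ IsManifold.maximalAtlas 𝓘(ℝ, Model n) ∞ M) {V W : VField n M}
    (hV : SmoothVField V) (hW : SmoothVField W) {p : M} (hp : p ∈ e.source) :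
    mvfderiv 𝓘(ℝ, Model n) e p (mlieBracket 𝓘(ℝ, Model n) V W p)
      = fderiv ℝ (chartRep e W) (e p) (chartRep e V (e p))
        - fderiv ℝ (chartRep e V) (e p) (chartRep e W (e p)) := by
  have ht := e.map_source hp
  have : IsManifold 𝓘(ℝ, Model n) (minSmoothness ℝ 2) M := by
    rw [minSmoothness_of_isRCLikeNormedField]; infer_instance
  have h1 := mpullback_mlieBracket (I := 𝓘(ℝ, Model n)) (I' := 𝓘(ℝ, Model n)) (n := ∞)
    (f := e.symm) (x₀ := e p) (V := V) (W := W) (hV.mdifferentiableAt _)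
    (hW.mdifferentiableAt _) (contMDiffAt_symm_of_mem_maximalAtlas he ht)
    (by simpa using ENat.LEInfty.out)
  have h2 := (mpullback_chart_symm_eventuallyEq he V hp).mlieBracket_vectorField_eq
    (mpullback_chart_symm_eventuallyEq he W hp)
  have h3 := (mpullback_chart_symm_eventuallyEq he (mlieBracket 𝓘(ℝ, Model n) V W) hp).self_of_nhds
  -- On the model space the manifold bracket is the usual `DW·V - DV·W`.
  have h4 := congrFun (mlieBracketWithin_eq_lieBracketWithin (𝕜 := ℝ) (V := chartRep e V)
    (W := chartRep e W) (s := Set.univ)) (e p)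
  have h5 : chartRep e (mlieBracket 𝓘(ℝ, Model n) V W) (e p)
      = mvfderiv 𝓘(ℝ, Model n) e p (mlieBracket 𝓘(ℝ, Model n) V W p) := by
    rw [chartRep, e.left_inv hp]
  rw [lieBracketWithin_univ] at h4
  exact h5.symm.trans (h3.symm.trans (h1.trans (h2.trans h4)))

/-- The vector field with expression `u` in the chart `e`. -/
def ofChartRep (e : OpenPartialHomeomorph M (Model n)) (u : Model n → Model n) : VField n M :=
  fun p => (mfderiv 𝓘(ℝ, Model n) 𝓘(ℝ, Model n) e p).inverse (u (e p))

/-- By definition `ofChartRep e u` is the pullback of `u` along `e`. It serves to exhibit `S'X`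
locally by its components. -/
theorem contMDiffAt_ofChartRep {e : OpenPartialHomeomorph M (Model n)}
    (he : e ∈ IsManifold.maximalAtlas 𝓘(ℝ, Model n) ∞ M) {u : Model n → Model n} {p : M}
    (hp : p ∈ e.source) (hu : ContDiffAt ℝ ∞ u (e p)) :
    ContMDiffAt 𝓘(ℝ, Model n) (𝓘(ℝ, Model n).prod 𝓘(ℝ, Model n)) ∞
      (fun q => TotalSpace.mk' (Model n) (E := fun q : M => TangentSpace 𝓘(ℝ, Model n) q) q
        (ofChartRep e u q)) p :=
  ContMDiffAt.mpullback_vectorField_preimage (m := ∞) (n := ∞) (V := u)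
    (I := 𝓘(ℝ, Model n)) (I' := 𝓘(ℝ, Model n))
    (contMDiffAt_vectorSpace_iff_contDiffAt.2 hu) (contMDiffAt_of_mem_maximalAtlas he hp)
    (isInvertible_mfderiv_chart he hp) le_rfl

theorem mvfderiv_chart_ofChartRep {e : OpenPartialHomeomorph M (Model n)}
    (he : e ∈ IsManifold.maximalAtlas 𝓘(ℝ, Model n) ∞ M) (u : Model n → Model n) {p : M}
    (hp : p ∈ e.source) : mvfderiv 𝓘(ℝ, Model n) e p (ofChartRep e u p) = u (e p) := by
  change mfderiv 𝓘(ℝ, Model n) 𝓘(ℝ, Model n) e p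
    ((mfderiv 𝓘(ℝ, Model n) 𝓘(ℝ, Model n) e p).inverse (u (e p))) = u (e p)
  obtain ⟨A, hA⟩ := isInvertible_mfderiv_chart he hp
  rw [← hA, ContinuousLinearMap.inverse_equiv]
  exact A.apply_symm_apply _

/-! ### Operations on smooth vector fields -/

theorem SmoothVField.zero : SmoothVField (0 : VField n M) :=
  Bundle.contMDiff_zeroSection ℝ (fun p : M => TangentSpace 𝓘(ℝ, Model n) p)

theorem SmoothVField.add {V W : VField n M} (hV : SmoothVField V) (hW : SmoothVField W) :
    SmoothVField (V + W) := ContMDiff.add_section hV hW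

theorem SmoothVField.neg {V : VField n M} (hV : SmoothVField V) :
    SmoothVField (-V) := ContMDiff.neg_section hV

theorem SmoothVField.sub {V W : VField n M} (hV : SmoothVField V) (hW : SmoothVField W) :
    SmoothVField (V - W) := ContMDiff.sub_section hV hW

theorem SmoothVField.app {A : EndField n M} {V : VField n M} (hA : SmoothEndField A)
    (hV : SmoothVField V) : SmoothVField (app A V) :=
  ContMDiff.clm_bundle_apply hA hV

theorem SmoothVField.mlieBracket {V W : VField n M} (hV : SmoothVField V) (hW : SmoothVField W) :
    SmoothVField (VectorField.mlieBracket 𝓘(ℝ, Model n) V W) := by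
  have : IsManifold 𝓘(ℝ, Model n) (((⊤ : ℕ∞) : ℕ∞ω) + 1) M := by
    simpa using (inferInstance : IsManifold 𝓘(ℝ, Model n) ∞ M)
  have : IsManifold 𝓘(ℝ, Model n) (minSmoothness ℝ 2) M := by
    rw [minSmoothness_of_isRCLikeNormedField]; infer_instance
  exact ContDiff.mlieBracket_vectorField (n := ⊤) (m := ⊤) hV hW (by simp)

theorem SmoothVField.covariantDerivative {nab : CovariantDerivative 𝓘(ℝ, Model n) (Model n)
      (fun p : M => TangentSpace 𝓘(ℝ, Model n) p)}
    (hn : CovariantDerivative.ContMDiffCovariantDerivative nab ∞) {X Y : VField n M}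
    (hX : SmoothVField X) (hY : SmoothVField Y) : SmoothVField (fun p => nab Y p (X p)) := by
  have h1 := hn.contMDiff.contMDiff (σ := Y) (by exact ContMDiff.contMDiffOn hY)
  rw [contMDiffOn_univ] at h1
  exact ContMDiff.clm_bundle_apply h1 hX

/-! ### The vertical distribution -/

section Vertical

variable {S pN : EndField n M}

/-- In adapted coordinates `S` moves the `x`-components into the `y`-slot, so the vertical vectors
are those without `x`-components. All later coordinate arguments test verticality this way. -/
theorem IsAdaptedChart.apply_eq_zero_iff {e : OpenPartialHomeomorph M (Model n)}
    (he : IsAdaptedChart S e) {p : M} (hp : p ∈ e.source) (v : TangentSpace 𝓘(ℝ, Model n) p) :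
    S p v = 0 ↔ (mvfderiv 𝓘(ℝ, Model n) e p v).1 = 0 := by
  have h := he.2 p hp v
  constructor
  · intro h0
    rw [h0, map_zero] at h
    exact (congrArg Prod.snd h).symm
  · intro h0
    apply mvfderiv_chart_injective he.1 hp
    rw [h, h0, map_zero]
    rfl

theorem IsNormalization.apply_eq_zero_iff (hS : IsTangentStructure S) (hN : IsNormalization S pN)
    {p : M} {v : TangentSpace 𝓘(ℝ, Model n) p} : pN p v = 0 ↔ S p v = 0 := by
  have h : (pN p).toLinearMap.ker = (S p).toLinearMap.ker := (hN.ker_eq p).trans (hS.range_eq_ker p)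
  exact SetLike.ext_iff.1 h v

theorem IsNormalization.comp_tangent (hS : IsTangentStructure S) (hN : IsNormalization S pN)
    (p : M) (v : TangentSpace 𝓘(ℝ, Model n) p) : pN p (S p v) = 0 :=
  (hN.apply_eq_zero_iff hS).2 (hS.sq_eq_zero p v)

theorem IsNormalization.apply_vertProj (hN : IsNormalization S pN)
    (p : M) (v : TangentSpace 𝓘(ℝ, Model n) p) : pN p (vertProj pN p v) = 0 := by
  simp [vertProj, hN.idem]

theorem fderiv_chartRep_fst {e : OpenPartialHomeomorph M (Model n)}
    (he : e ∈ IsManifold.maximalAtlas 𝓘(ℝ, Model n) ∞ M) {V : VField n M} (hV : SmoothVField V)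
    {p : M} (hp : p ∈ e.source) (w : Model n) :
    (fderiv ℝ (chartRep e V) (e p) w).1 = fderiv ℝ (fun z => (chartRep e V z).1) (e p) w := by
  rw [fderiv.fst ((contDiffAt_chartRep he hV hp).differentiableAt (by simp))]
  rfl

/-- The `x`-components of a vertical field vanish identically near the point, hence so do their
derivatives. -/
theorem fderiv_chartRep_fst_of_vertical {e : OpenPartialHomeomorph M (Model n)}
    (he : IsAdaptedChart S e) {V : VField n M} (hV : SmoothVField V) (hSV : ∀ p, S p (V p) = 0)
    {p : M} (hp : p ∈ e.source) (w : Model n) :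
    (fderiv ℝ (chartRep e V) (e p) w).1 = 0 := by
  rw [fderiv_chartRep_fst he.1 hV hp]
  have h : (fun z => (chartRep e V z).1) =ᶠ[𝓝 (e p)] fun _ => 0 := by
    filter_upwards [e.open_target.mem_nhds (e.map_source hp)] with z hz
    exact (he.apply_eq_zero_iff (e.map_target hz) _).1 (hSV _)
  rw [h.fderiv_eq]
  simp

/-- The vertical distribution is integrable. -/
theorem IsNormalization.apply_mlieBracket_vertical (hS : IsTangentStructure S)
    (hN : IsNormalization S pN) {V W : VField n M} (hV : SmoothVField V) (hW : SmoothVField W)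
    (hSV : ∀ p, pN p (V p) = 0) (hSW : ∀ p, pN p (W p) = 0) (p : M) :
    pN p (mlieBracket 𝓘(ℝ, Model n) V W p) = 0 := by
  obtain ⟨e, he, hp⟩ := hS.integrable p
  rw [hN.apply_eq_zero_iff hS, he.apply_eq_zero_iff hp, mvfderiv_chart_mlieBracket he.1 hV hW hp,
    Prod.fst_sub,
    fderiv_chartRep_fst_of_vertical he hV (fun p => (hN.apply_eq_zero_iff hS).1 (hSV p)) hp,
    fderiv_chartRep_fst_of_vertical he hW (fun p => (hN.apply_eq_zero_iff hS).1 (hSW p)) hp,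
    sub_zero]

/-! ### The tensor `S'` -/

theorem IsNormalization.apply_sPrime (hS : IsTangentStructure S) (hN : IsNormalization S pN)
    (X : VField n M) (p : M) : pN p (sPrime S pN X p) = sPrime S pN X p :=
  ((sPrime_apply_eq_iff hS hN X p _).1 rfl).1

theorem IsNormalization.tangent_sPrime (hS : IsTangentStructure S) (hN : IsNormalization S pN)
    (X : VField n M) (p : M) : S p (sPrime S pN X p) = vertProj pN p (X p) :=
  ((sPrime_apply_eq_iff hS hN X p _).1 rfl).2

theorem IsNormalization.tangent_comp (hS : IsTangentStructure S) (hN : IsNormalization S pN)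
    (p : M) (v : TangentSpace 𝓘(ℝ, Model n) p) : S p (pN p v) = S p v := by
  have h : S p (vertProj pN p v) = 0 := (hN.apply_eq_zero_iff hS).1 (hN.apply_vertProj p v)
  have h2 : S p v - S p (pN p v) = 0 := by simpa [vertProj] using h
  exact (sub_eq_zero.1 h2).symm

theorem SmoothVField.vertProj (hN : IsNormalization S pN) {X : VField n M} (hX : SmoothVField X) :
    SmoothVField (TangentMfd.app (vertProj pN) X) := by
  have h : TangentMfd.app (TangentMfd.vertProj pN) X = X - TangentMfd.app pN X := by
    funext p; simp [TangentMfd.app, TangentMfd.vertProj]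
  rw [h]
  exact hX.sub (hX.app hN.smooth)

/-- `sPrime` is defined pointwise by choice, so smoothness needs a local formula: in an adapted
chart `S'X` is the horizontal part of the field whose `x`-components are the `y`-components of `p_T
X`. The uniqueness in `sPrime_apply_eq_iff` identifies the two. -/
theorem SmoothVField.sPrime (hS : IsTangentStructure S) (hN : IsNormalization S pN)
    {X : VField n M} (hX : SmoothVField X) : SmoothVField (sPrime S pN X) := by
  intro p
  obtain ⟨e, he, hp⟩ := hS.integrable p
  set T := TangentMfd.app (TangentMfd.vertProj pN) X with hTdef
  have hT : SmoothVField T := hX.vertProj hN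
  set u : Model n → Model n := fun z => ((chartRep e T z).2, 0) with hu
  have hc := contDiffAt_chartRep he.1 hT hp
  have h1 := contMDiffAt_ofChartRep he.1 (u := u) hp (hc.snd.prodMk contDiffAt_const)
  refine (ContMDiffAt.clm_bundle_apply (hN.smooth p) h1).congr_of_eventuallyEq ?_
  filter_upwards [e.open_source.mem_nhds hp] with m hm
  congr 1
  rw [sPrime_apply_eq_iff hS hN]
  refine ⟨hN.idem _ _, ?_⟩
  rw [hN.tangent_comp hS]
  apply mvfderiv_chart_injective he.1 hm
  rw [he.2 m hm, mvfderiv_chart_ofChartRep he.1 u hm]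
  have h2 : chartRep e T (e m)
      = mvfderiv 𝓘(ℝ, Model n) e m (TangentMfd.vertProj pN m (X m)) := by
    rw [chartRep, e.left_inv hm]; rfl
  have h3 := (he.apply_eq_zero_iff hm _).1
    ((hN.apply_eq_zero_iff hS).1 (hN.apply_vertProj m (X m)))
  rw [← h2] at h3 ⊢
  exact Prod.ext h3.symm rfl

theorem IsHorizontal.sPrime (hS : IsTangentStructure S) (hN : IsNormalization S pN)
    {X : VField n M} (hX : SmoothVField X) : IsHorizontal pN (sPrime S pN X) :=
  ⟨hX.sPrime hS hN, hN.apply_sPrime hS X⟩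

/-- The horizontal part of `[SZ, S'E]` is `Z`, for `Z` horizontal. -/
theorem IsEulerField.apply_mlieBracket_sPrime {E : VField n M} (hS : IsTangentStructure S)
    (hE : IsEulerField S E) (hN : IsNormalization S pN) {Z : VField n M} (hZ : IsHorizontal pN Z)
    (p : M) :
    pN p (mlieBracket 𝓘(ℝ, Model n) (app S Z) (sPrime S pN E) p) = Z p := by
  obtain ⟨e, he, hp, heul⟩ := hE.euler p
  have hSZ : SmoothVField (app S Z) := hZ.1.app hS.smooth
  have hJ : SmoothVField (sPrime S pN E) := hE.smooth.sPrime hS hN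
  have hSJ : ∀ m, S m (sPrime S pN E m) = E m := by
    intro m
    rw [hN.tangent_sPrime hS]
    obtain ⟨v, hv⟩ := hE.vertical m
    simp [vertProj, ← hv, hN.comp_tangent hS]
  -- Since `S(S'E) = E`, the `x`-components of `S'E` are the `y`-components of `E`, that is `yⁱ +
  -- qⁱ`.
  have hrep : ∀ z ∈ e.target,
      (chartRep e (sPrime S pN E) z).1 = (chartRep e E z).2 := by
    intro z hz
    have h := he.2 _ (e.map_target hz) (sPrime S pN E (e.symm z))
    rw [hSJ] at h
    exact (congrArg Prod.snd h).symm
  have hcE := contDiffAt_chartRep he.1 hE.smooth hp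
  have hdE : DifferentiableAt ℝ (fun z => (chartRep e E z).2) (e p) :=
    hcE.snd.differentiableAt (by simp)
  -- `g` is the coordinate expression of the foliated functions `qⁱ`.
  set g : Model n → EuclideanSpace ℝ (Fin n) := fun z => (chartRep e E z).2 - z.2 with hg
  have hdg : DifferentiableAt ℝ g (e p) := hdE.sub differentiableAt_snd
  have h1 : (fun m' : M => (mvfderiv 𝓘(ℝ, Model n) e m' (E m')).2 - (e m').2)
      =ᶠ[𝓝 p] g ∘ e := by
    filter_upwards [e.open_source.mem_nhds hp] with m hm
    simp only [hg, Function.comp, chartRep]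
    rw [e.left_inv hm]
  have h2 : ∀ v : TangentSpace 𝓘(ℝ, Model n) p, mvfderiv 𝓘(ℝ, Model n) (g ∘ e) p v
      = fderiv ℝ g (e p) (mvfderiv 𝓘(ℝ, Model n) e p v) := by
    intro v
    have h := mfderiv_comp_apply (I := 𝓘(ℝ, Model n)) (I' := 𝓘(ℝ, Model n))
      (I'' := 𝓘(ℝ, EuclideanSpace ℝ (Fin n))) p hdg.mdifferentiableAt
      ((mdifferentiable_of_mem_maximalAtlas he.1).mdifferentiableAt hp) v
    rw [mfderiv_eq_fderiv] at h
    exact h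
  have h3 := heul p hp (Z p)
  have h4 : mvfderiv 𝓘(ℝ, Model n)
      (fun m' : M => (mvfderiv 𝓘(ℝ, Model n) e m' (E m')).2 - (e m').2) p (S p (Z p))
      = mvfderiv 𝓘(ℝ, Model n) (g ∘ e) p (S p (Z p)) := by
    have h := Filter.EventuallyEq.mfderiv_eq (I := 𝓘(ℝ, Model n))
      (I' := 𝓘(ℝ, EuclideanSpace ℝ (Fin n))) h1
    exact congrArg (fun L : Model n →L[ℝ] EuclideanSpace ℝ (Fin n) => L (S p (Z p))) h
  rw [h4, h2, he.2 p hp, hg, fderiv_fun_sub hdE differentiableAt_snd, fderiv_snd] at h3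
  -- As `SZ` annihilates `q`, differentiating `y + q` along `SZ` gives the derivative of `y`, i.e.
  -- the `x`-components of `Z`.
  have h5 : fderiv ℝ (fun z => (chartRep e E z).2) (e p) (0, (mvfderiv 𝓘(ℝ, Model n) e p (Z p)).1)
      = (mvfderiv 𝓘(ℝ, Model n) e p (Z p)).1 := sub_eq_zero.1 h3
  have h6 : chartRep e (app S Z) (e p) = (0, (mvfderiv 𝓘(ℝ, Model n) e p (Z p)).1) := by
    rw [← he.2 p hp, chartRep, e.left_inv hp]; rfl
  have h7 : (fun z => (chartRep e (sPrime S pN E) z).1)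
      =ᶠ[𝓝 (e p)] fun z => (chartRep e E z).2 :=
    Filter.eventually_of_mem (e.open_target.mem_nhds (e.map_source hp)) hrep
  have h8 : (mvfderiv 𝓘(ℝ, Model n) e p
      (mlieBracket 𝓘(ℝ, Model n) (app S Z) (sPrime S pN E) p)).1
      = (mvfderiv 𝓘(ℝ, Model n) e p (Z p)).1 := by
    rw [mvfderiv_chart_mlieBracket he.1 hSZ hJ hp, Prod.fst_sub,
      fderiv_chartRep_fst_of_vertical he hSZ (fun m => hS.sq_eq_zero m _) hp, sub_zero,
      fderiv_chartRep_fst he.1 hJ hp, h7.fderiv_eq, h6, h5]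
  have h9 : pN p (mlieBracket 𝓘(ℝ, Model n) (app S Z) (sPrime S pN E) p - Z p) = 0 := by
    rw [hN.apply_eq_zero_iff hS, he.apply_eq_zero_iff hp, map_sub, Prod.fst_sub, h8, sub_self]
  rw [map_sub, hZ.2, sub_eq_zero] at h9
  exact h9

end Vertical

/-! ### The differential Bianchi identity -/

/-- The differential Bianchi identity for the curvature `R` of a biadditive operation `d` relative
to a Lie bracket `br`, applied to `J`, for arguments `X, Y, a` such that `(X, a)` and `(Y, a)` have
no torsion and such that the torsion of `(X, Y)` does not contribute to `R(·, a)J`. -/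
theorem curvature_eq_of_bianchi {G : Type*} [AddCommGroup G] (d br : G →+ G →+ G)
    (halt : ∀ x y, br x y = -br y x)
    (hjac : ∀ x y z, br x (br y z) = br (br x y) z + br y (br x z))
    (R : G → G → G → G) (hR : ∀ x y z, R x y z = d x (d y z) - d y (d x z) - d (br x y) z)
    {a X Y J : G} (hX : d a X - d X a = br a X) (hY : d a Y - d Y a = br a Y)
    (hXY : R (br X Y - (d X Y - d Y X)) a J = 0) :
    R X Y (d a J) = (d a (R X Y J) - R (d a X) Y J - R X (d a Y) J)
      + (d X (R Y a J) - R (d X Y) a J - R Y (d X a) J - R Y a (d X J))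
      - (d Y (R X a J) - R (d Y X) a J - R X (d Y a) J - R X a (d Y J)) := by
  -- Eliminating `d a X`, `d a Y` and `br Y (br a X)`, and orienting the remaining brackets, leaves
  -- sums of compositions of `d` that `abel` can compare. The two sides then differ by minus the
  -- torsion term `hXY`.
  have hX' : d a X = br a X + d X a := by rw [← hX]; abel
  have hY' : d a Y = br a Y + d Y a := by rw [← hY]; abel
  have hJ := hjac a X Y
  rw [halt (br a X) Y] at hJ
  have hJ' : br Y (br a X) = br X (br a Y) - br a (br X Y) := by rw [hJ]; abel
  have e1 := halt Y a
  have e2 := halt X a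
  have e3 := halt (br X Y) a
  have e4 := halt (d X a) Y
  have e5 := halt (br a X) Y
  simp only [hR, hX', hY', map_sub, map_add, map_neg, AddMonoidHom.sub_apply,
    AddMonoidHom.add_apply, AddMonoidHom.neg_apply, e1, e2, e3, e4, e5, hJ'] at hXY ⊢
  rw [← sub_eq_zero]
  rw [← neg_eq_zero] at hXY
  rw [← hXY]
  abel

/-! ### The canonical connection -/

section CanonicalConn

variable {S pN : EndField n M} {nab : CovariantDerivative 𝓘(ℝ, Model n) (Model n)
  (fun p : M => TangentSpace 𝓘(ℝ, Model n) p)}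

theorem app_add (A : EndField n M) (X Y : VField n M) : app A (X + Y) = app A X + app A Y := by
  funext p; simp [app]

theorem app_sub (A : EndField n M) (X Y : VField n M) : app A (X - Y) = app A X - app A Y := by
  funext p; simp [app]

theorem app_vertProj (X : VField n M) : app (vertProj pN) X = X - app pN X := by
  funext p; simp [app, vertProj]

theorem mlieBracket_add_right_of_smooth {X Y Z : VField n M} (hY : SmoothVField Y)
    (hZ : SmoothVField Z) : mlieBracket 𝓘(ℝ, Model n) X (Y + Z)
      = mlieBracket 𝓘(ℝ, Model n) X Y + mlieBracket 𝓘(ℝ, Model n) X Z :=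
  funext fun p => mlieBracket_add_right (hY.mdifferentiableAt p) (hZ.mdifferentiableAt p)

theorem mlieBracket_add_left_of_smooth {X Y Z : VField n M} (hX : SmoothVField X)
    (hY : SmoothVField Y) : mlieBracket 𝓘(ℝ, Model n) (X + Y) Z
      = mlieBracket 𝓘(ℝ, Model n) X Z + mlieBracket 𝓘(ℝ, Model n) Y Z :=
  funext fun p => mlieBracket_add_left (hX.mdifferentiableAt p) (hY.mdifferentiableAt p)

theorem SmoothVField.canonicalConn (hN : IsNormalization S pN)
    (hn : CovariantDerivative.ContMDiffCovariantDerivative nab ∞) {X Y : VField n M}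
    (hX : SmoothVField X) (hY : SmoothVField Y) :
    SmoothVField (canonicalConn pN nab X Y) :=
  ((((SmoothVField.covariantDerivative hn (hX.app hN.smooth) (hY.app hN.smooth)).app
    hN.smooth).add ((SmoothVField.covariantDerivative hn (hX.vertProj hN)
      (hY.vertProj hN)).vertProj hN)).add
    (((hX.vertProj hN).mlieBracket (hY.app hN.smooth)).app hN.smooth)).add
    (((hX.app hN.smooth).mlieBracket (hY.vertProj hN)).vertProj hN)

theorem canonicalConn_add_left (hN : IsNormalization S pN) {X X' : VField n M}
    (hX : SmoothVField X) (hX' : SmoothVField X') (Y : VField n M) :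
    canonicalConn pN nab (X + X') Y = canonicalConn pN nab X Y + canonicalConn pN nab X' Y := by
  funext p
  simp only [canonicalConn, app_add, Pi.add_apply, map_add,
    mlieBracket_add_left_of_smooth (hX.vertProj hN) (hX'.vertProj hN),
    mlieBracket_add_left_of_smooth (hX.app hN.smooth) (hX'.app hN.smooth)]
  abel

theorem canonicalConn_add_right (hN : IsNormalization S pN) (X : VField n M) {Y Y' : VField n M}
    (hY : SmoothVField Y) (hY' : SmoothVField Y') :
    canonicalConn pN nab X (Y + Y') = canonicalConn pN nab X Y + canonicalConn pN nab X Y' := by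
  funext p
  have h1 := nab.isCovariantDerivativeOn.add ((hY.app hN.smooth).mdifferentiableAt p)
    ((hY'.app hN.smooth).mdifferentiableAt p) (Set.mem_univ p)
  have h2 := nab.isCovariantDerivativeOn.add ((hY.vertProj hN).mdifferentiableAt p)
    ((hY'.vertProj hN).mdifferentiableAt p) (Set.mem_univ p)
  simp only [canonicalConn, app_add, Pi.add_apply, map_add, h1, h2, add_apply,
    mlieBracket_add_right_of_smooth (hY.vertProj hN) (hY'.vertProj hN),
    mlieBracket_add_right_of_smooth (hY.app hN.smooth) (hY'.app hN.smooth)]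
  abel

/-- The canonical connection is a local operator. -/
theorem canonicalConn_congr_right (hN : IsNormalization S pN) (X : VField n M) {Y Y' : VField n M}
    (hY' : SmoothVField Y') {p : M} (h : Y =ᶠ[𝓝 p] Y') :
    canonicalConn pN nab X Y p = canonicalConn pN nab X Y' p := by
  have happ : ∀ A : EndField n M, app A Y =ᶠ[𝓝 p] app A Y' := fun A => by
    filter_upwards [h] with q hq
    exact congrArg (A q) hq
  have hnab : ∀ A : EndField n M, SmoothVField (app A Y') →
      nab (app A Y) p = nab (app A Y') p := fun A hA => by
    refine nab.isCovariantDerivativeOn.congr_of_eventuallyEq (s := Set.univ) ?_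
      (hA.mdifferentiableAt p) Filter.univ_mem (happ A)
    refine (hA.mdifferentiableAt p).congr_of_eventuallyEq ?_
    filter_upwards [happ A] with q hq
    rw [hq]
  have hbr : ∀ (A : EndField n M) (W : VField n M), mlieBracket 𝓘(ℝ, Model n) W (app A Y) p
      = mlieBracket 𝓘(ℝ, Model n) W (app A Y') p := fun A W =>
    Filter.EventuallyEq.mlieBracket_vectorField_eq Filter.EventuallyEq.rfl (happ A)
  simp only [canonicalConn]
  rw [hnab _ (hY'.app hN.smooth), hnab _ (hY'.vertProj hN), hbr, hbr]

theorem canonicalConn_horizontal_horizontal {X Y : VField n M} (hX : app pN X = X)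
    (hY : app pN Y = Y) : canonicalConn pN nab X Y = app pN (fun p => nab Y p (X p)) := by
  funext p
  simp only [canonicalConn, app_vertProj, hX, hY]
  simp [app]

theorem canonicalConn_vertical_horizontal {X Y : VField n M} (hX : app pN X = 0)
    (hY : app pN Y = Y) :
    canonicalConn pN nab X Y = app pN (mlieBracket 𝓘(ℝ, Model n) X Y) := by
  funext p
  simp only [canonicalConn, app_vertProj, hX, hY]
  simp [app]

theorem canonicalConn_horizontal_vertical {X Y : VField n M} (hX : app pN X = X)
    (hY : app pN Y = 0) :
    canonicalConn pN nab X Y = app (vertProj pN) (mlieBracket 𝓘(ℝ, Model n) X Y) := by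
  funext p
  simp only [canonicalConn, app_vertProj, hX, hY]
  simp [app, vertProj]

theorem IsNormalization.app_app (hN : IsNormalization S pN) (X : VField n M) :
    app pN (app pN X) = app pN X := funext fun p => hN.idem p (X p)

theorem IsNormalization.app_app_vertProj (hN : IsNormalization S pN) (X : VField n M) :
    app pN (app (vertProj pN) X) = 0 := funext fun p => hN.apply_vertProj p (X p)

theorem IsNormalization.app_app_tangent (hS : IsTangentStructure S) (hN : IsNormalization S pN)
    (X : VField n M) : app pN (app S X) = 0 := funext fun p => hN.comp_tangent hS p (X p)

theorem IsNormalization.app_mlieBracket_vertical (hS : IsTangentStructure S)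
    (hN : IsNormalization S pN) {V W : VField n M} (hV : SmoothVField V) (hW : SmoothVField W)
    (hpV : app pN V = 0) (hpW : app pN W = 0) : app pN (mlieBracket 𝓘(ℝ, Model n) V W) = 0 :=
  funext fun p => hN.apply_mlieBracket_vertical hS hV hW (congrFun hpV) (congrFun hpW) p

/-- `D` preserves `N𝒱`, so derivatives of horizontal fields remain admissible arguments of `r` and
`K`. -/
theorem IsHorizontal.canonicalConn (hN : IsNormalization S pN)
    (hn : CovariantDerivative.ContMDiffCovariantDerivative nab ∞) {X Y : VField n M}
    (hX : SmoothVField X) (hY : IsHorizontal pN Y) :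
    IsHorizontal pN (canonicalConn pN nab X Y) := by
  refine ⟨hX.canonicalConn hN hn hY.1, fun p => ?_⟩
  have hY' : app pN Y = Y := funext hY.2
  simp [TangentMfd.canonicalConn, app_vertProj, hY', hN.idem]

/-- The vertical part of `W` contributes only a vertical bracket with `V`, which `p_N` kills. Hence
`p_N[V, ·]` factors through `TM/T𝒱`, as a Bott connection does. -/
theorem mlieBracket_app_horizontal (hS : IsTangentStructure S)
    (hN : IsNormalization S pN) {V W : VField n M} (hV : SmoothVField V) (hW : SmoothVField W)
    (hpV : app pN V = 0) : app pN (mlieBracket 𝓘(ℝ, Model n) V (app pN W))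
      = app pN (mlieBracket 𝓘(ℝ, Model n) V W) := by
  have h : W = app pN W + app (vertProj pN) W := by rw [app_vertProj]; abel
  conv_rhs => rw [h, mlieBracket_add_right_of_smooth (hW.app hN.smooth) (hW.vertProj hN), app_add,
    hN.app_mlieBracket_vertical hS hV (hW.vertProj hN) hpV (hN.app_app_vertProj W), add_zero]

theorem mlieBracket_jacobi {X Y Z : VField n M} (hX : SmoothVField X) (hY : SmoothVField Y)
    (hZ : SmoothVField Z) :
    mlieBracket 𝓘(ℝ, Model n) X (mlieBracket 𝓘(ℝ, Model n) Y Z)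
      = mlieBracket 𝓘(ℝ, Model n) (mlieBracket 𝓘(ℝ, Model n) X Y) Z
        + mlieBracket 𝓘(ℝ, Model n) Y (mlieBracket 𝓘(ℝ, Model n) X Z) := by
  have h2 : minSmoothness ℝ 2 ≤ (∞ : ℕ∞ω) := by
    rw [minSmoothness_of_isRCLikeNormedField]; exact ENat.LEInfty.out
  have : IsManifold 𝓘(ℝ, Model n) (minSmoothness ℝ 3) M := by
    rw [minSmoothness_of_isRCLikeNormedField]; infer_instance
  exact leibniz_identity_mlieBracket (ContMDiff.of_le hX h2) (ContMDiff.of_le hY h2)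
    (ContMDiff.of_le hZ h2)

/-- The canonical connection has no curvature on the horizontal bundle along the leaves. -/
theorem curv_vertical_vertical (hS : IsTangentStructure S) (hN : IsNormalization S pN)
    {V W Z : VField n M} (hV : SmoothVField V) (hW : SmoothVField W) (hpV : app pN V = 0)
    (hpW : app pN W = 0) (hZ : SmoothVField Z) (hpZ : app pN Z = Z) :
    curv (canonicalConn pN nab) V W Z = 0 := by
  simp only [curv]
  -- Once the inner projections are dropped, the curvature is `p_N` of the Jacobi expression of `V`,
  -- `W`, `Z`.
  rw [canonicalConn_vertical_horizontal hpW hpZ, canonicalConn_vertical_horizontal hpV hpZ,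
    canonicalConn_vertical_horizontal hpV (hN.app_app _),
    canonicalConn_vertical_horizontal hpW (hN.app_app _),
    canonicalConn_vertical_horizontal (hN.app_mlieBracket_vertical hS hV hW hpV hpW) hpZ,
    mlieBracket_app_horizontal hS hN hV (hW.mlieBracket hZ) hpV,
    mlieBracket_app_horizontal hS hN hW (hV.mlieBracket hZ) hpW,
    mlieBracket_jacobi hV hW hZ, app_add]
  abel

/-- The mixed torsion of the canonical connection vanishes. -/
theorem canonicalConn_mixed_torsion {V X : VField n M}
    (hpV : app pN V = 0) (hpX : app pN X = X) :
    canonicalConn pN nab V X - canonicalConn pN nab X V = mlieBracket 𝓘(ℝ, Model n) V X := by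
  rw [canonicalConn_vertical_horizontal hpV hpX, canonicalConn_horizontal_vertical hpX hpV,
    mlieBracket_swap (V := X), app_vertProj]
  have h : app pN (-mlieBracket 𝓘(ℝ, Model n) V X) = -app pN (mlieBracket 𝓘(ℝ, Model n) V X) := by
    funext p; simp [app]
  rw [h]
  abel

/-- The horizontal part of the torsion of the canonical connection vanishes. -/
theorem canonicalConn_horizontal_torsion (hnab : nab.torsion = 0) {X Y : VField n M}
    (hX : SmoothVField X) (hY : SmoothVField Y) (hpX : app pN X = X) (hpY : app pN Y = Y) :
    canonicalConn pN nab X Y - canonicalConn pN nab Y X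
      = app pN (mlieBracket 𝓘(ℝ, Model n) X Y) := by
  rw [canonicalConn_horizontal_horizontal hpX hpY, canonicalConn_horizontal_horizontal hpY hpX,
    ← app_sub]
  congr 1
  funext p
  exact nab.torsion_eq_zero_iff.1 hnab (hX.mdifferentiableAt p) (hY.mdifferentiableAt p)

/-- `D_{SZ} S'E = Z` for `Z` horizontal. -/
theorem IsEulerField.canonicalConn_sPrime {E : VField n M} (hS : IsTangentStructure S)
    (hE : IsEulerField S E) (hN : IsNormalization S pN) {Z : VField n M} (hZ : IsHorizontal pN Z) :
    canonicalConn pN nab (app S Z) (sPrime S pN E) = Z := by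
  rw [canonicalConn_vertical_horizontal (hN.app_app_tangent hS Z)
    (funext (hN.apply_sPrime hS E))]
  exact funext (hE.apply_mlieBracket_sPrime hS hN hZ)

/-! ### Bianchi identity on the group of smooth vector fields -/

variable (n M) in
/-- The group of smooth vector fields on `M`. -/
def smoothFields : AddSubgroup (VField n M) where
  carrier := {X | SmoothVField X}
  add_mem' hX hY := SmoothVField.add hX hY
  zero_mem' := SmoothVField.zero
  neg_mem' hX := SmoothVField.neg hX

/-- The Lie bracket of smooth vector fields, as a biadditive map. -/
def bracketHom : smoothFields n M →+ smoothFields n M →+ smoothFields n M :=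
  AddMonoidHom.mk' (fun X => AddMonoidHom.mk'
    (fun Y => ⟨mlieBracket 𝓘(ℝ, Model n) X.1 Y.1, X.2.mlieBracket Y.2⟩)
    fun Y Y' => Subtype.ext (mlieBracket_add_right_of_smooth Y.2 Y'.2))
    fun X X' => AddMonoidHom.ext fun _ => Subtype.ext (mlieBracket_add_left_of_smooth X.2 X'.2)

/-- The canonical connection on smooth vector fields, as a biadditive map. -/
def canonicalConnHom (hN : IsNormalization S pN)
    (hn : CovariantDerivative.ContMDiffCovariantDerivative nab ∞) :
    smoothFields n M →+ smoothFields n M →+ smoothFields n M :=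
  AddMonoidHom.mk' (fun X => AddMonoidHom.mk'
    (fun Y => ⟨canonicalConn pN nab X.1 Y.1, SmoothVField.canonicalConn hN hn X.2 Y.2⟩)
    fun Y Y' => Subtype.ext (canonicalConn_add_right hN X.1 Y.2 Y'.2))
    fun X X' => AddMonoidHom.ext fun Y => Subtype.ext (canonicalConn_add_left hN X.2 X'.2 Y.1)

theorem coe_canonicalConnHom (hN : IsNormalization S pN)
    (hn : CovariantDerivative.ContMDiffCovariantDerivative nab ∞) (X Y : smoothFields n M) :
    (canonicalConnHom hN hn X Y : VField n M) = canonicalConn pN nab X Y := rfl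

theorem SmoothVField.curv (hN : IsNormalization S pN)
    (hn : CovariantDerivative.ContMDiffCovariantDerivative nab ∞) {X Y Z : VField n M}
    (hX : SmoothVField X) (hY : SmoothVField Y) (hZ : SmoothVField Z) :
    SmoothVField (curv (TangentMfd.canonicalConn pN nab) X Y Z) :=
  ((hX.canonicalConn hN hn (hY.canonicalConn hN hn hZ)).sub
    (hY.canonicalConn hN hn (hX.canonicalConn hN hn hZ))).sub
    ((hX.mlieBracket hY).canonicalConn hN hn hZ)

/-- The curvature of the canonical connection on horizontal arguments, from the differential
Bianchi identity for `X, Y, SZ` and the equality `D_{SZ} S'E = Z`. -/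
theorem curv_canonicalConn_eq {E : VField n M} (hS : IsTangentStructure S)
    (hE : IsEulerField S E) (hN : IsNormalization S pN)
    (hn : CovariantDerivative.ContMDiffCovariantDerivative nab ∞) (ht : nab.torsion = 0)
    {D : VField n M → VField n M → VField n M} (hD : D = canonicalConn pN nab)
    {X Y Z : VField n M} (hX : IsHorizontal pN X) (hY : IsHorizontal pN Y)
    (hZ : IsHorizontal pN Z) {J : VField n M} (hJ : J = sPrime S pN E) :
    curv D X Y Z = (D (app S Z) (curv D X Y J) - curv D (D (app S Z) X) Y J
        - curv D X (D (app S Z) Y) J)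
      + (D X (curv D Y (app S Z) J) - curv D (D X Y) (app S Z) J - curv D Y (D X (app S Z)) J
        - curv D Y (app S Z) (D X J))
      - (D Y (curv D X (app S Z) J) - curv D (D Y X) (app S Z) J - curv D X (D Y (app S Z)) J
        - curv D X (app S Z) (D Y J)) := by
  have hSZ : SmoothVField (app S Z) := hZ.1.app hS.smooth
  have hJs : IsHorizontal pN J := hJ ▸ IsHorizontal.sPrime hS hN hE.smooth
  have hpX : app pN X = X := funext hX.2
  have hpY : app pN Y = Y := funext hY.2
  have hpJ : app pN J = J := funext hJs.2
  have hpa : app pN (app S Z) = 0 := hN.app_app_tangent hS Z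
  have hbr := hX.1.mlieBracket hY.1
  -- The algebraic identity needs only additivity, which bracket and connection have on smooth
  -- fields; hence the passage to the subgroup `smoothFields`.
  have key := curvature_eq_of_bianchi (canonicalConnHom hN hn) bracketHom
    (fun x y => Subtype.ext (mlieBracket_swap (V := x.1) (W := y.1)))
    (fun x y z => Subtype.ext (mlieBracket_jacobi x.2 y.2 z.2))
    (fun x y z => ⟨curv (canonicalConn pN nab) x.1 y.1 z.1, x.2.curv hN hn y.2 z.2⟩)
    (fun x y z => Subtype.ext rfl) (a := ⟨app S Z, hSZ⟩) (X := ⟨X, hX.1⟩) (Y := ⟨Y, hY.1⟩)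
    (J := ⟨J, hJs.1⟩) (Subtype.ext (canonicalConn_mixed_torsion hpa hpX))
    (Subtype.ext (canonicalConn_mixed_torsion hpa hpY)) (Subtype.ext (by
      change curv (canonicalConn pN nab) (mlieBracket 𝓘(ℝ, Model n) X Y
        - (canonicalConn pN nab X Y - canonicalConn pN nab Y X)) (app S Z) J = 0
      -- The first argument becomes `[X,Y] - p_N[X,Y] = p_T[X,Y]`, so both arguments of the
      -- curvature are vertical.
      rw [canonicalConn_horizontal_torsion ht hX.1 hY.1 hpX hpY, ← app_vertProj]
      exact curv_vertical_vertical hS hN (hbr.vertProj hN) hSZ (hN.app_app_vertProj _) hpa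
        hJs.1 hpJ))
  have h2 := congrArg Subtype.val key
  have hDJ : canonicalConn pN nab (app S Z) J = Z := hJ ▸ hE.canonicalConn_sPrime hS hN hZ
  simp only [AddSubgroup.coe_add, AddSubgroup.coe_sub, coe_canonicalConnHom, hDJ] at h2
  rw [hD]
  exact h2

end CanonicalConn

end TangentMfd

end

/-! ### Replacing the curvature by `r` and `K` on `U` -/

theorem proposition3p10 {n : ℕ} {M : Type*} [TopologicalSpace M] [T2Space M]
    [SecondCountableTopology M] [ChartedSpace (TangentMfd.Model n) M]
    [IsManifold 𝓘(ℝ, TangentMfd.Model n) ∞ M]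
    (S pN : TangentMfd.EndField n M) (E : TangentMfd.VField n M)
    (γ : TangentMfd.BilinField n M)
    (nab : CovariantDerivative 𝓘(ℝ, TangentMfd.Model n) (TangentMfd.Model n)
      (fun p : M => TangentSpace 𝓘(ℝ, TangentMfd.Model n) p))
    (hS : TangentMfd.IsTangentStructure S) (hE : TangentMfd.IsEulerField S E)
    (hN : TangentMfd.IsNormalization S pN) (hγ : TangentMfd.IsCompatibleMetric S pN γ)
    (hnab : TangentMfd.IsLeviCivita γ nab)
    (D : TangentMfd.VField n M → TangentMfd.VField n M → TangentMfd.VField n M)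
    (hD : D = TangentMfd.canonicalConn pN nab)
    (U : Set M) (hU : IsOpen U)
    (r : TangentMfd.VField n M → TangentMfd.VField n M → TangentMfd.VField n M)
    (K : TangentMfd.VField n M → TangentMfd.VField n M → TangentMfd.VField n M →
      TangentMfd.VField n M)
    (hr : ∀ X Y, TangentMfd.IsHorizontal pN X → TangentMfd.IsHorizontal pN Y →
      ∀ p ∈ U, r X Y p = TangentMfd.curv D X Y (TangentMfd.sPrime S pN E) p)
    (hK : ∀ V W Z, TangentMfd.IsHorizontal pN V → TangentMfd.IsHorizontal pN W →
      TangentMfd.IsHorizontal pN Z →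
      ∀ p ∈ U, K V W Z p = TangentMfd.curv D V (TangentMfd.app S W) Z p) :
    ∀ X Y Z, TangentMfd.IsHorizontal pN X → TangentMfd.IsHorizontal pN Y →
      TangentMfd.IsHorizontal pN Z →
      ∀ p ∈ U, TangentMfd.curv D X Y Z p = TangentMfd.curvExpr S pN E D r K X Y Z p := by
  intro X Y Z hX hY hZ p hp
  have hSZ := hZ.1.app hS.smooth
  have hJ := TangentMfd.IsHorizontal.sPrime hS hN hE.smooth
  have hDh : ∀ {A B : TangentMfd.VField n M}, TangentMfd.SmoothVField A →
      TangentMfd.IsHorizontal pN B → TangentMfd.IsHorizontal pN (D A B) := fun hA hB =>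
    hD ▸ TangentMfd.IsHorizontal.canonicalConn hN hnab.smooth hA hB
  have hDS : ∀ {A : TangentMfd.VField n M}, TangentMfd.IsHorizontal pN A →
      TangentMfd.SmoothVField (D A (TangentMfd.app S Z)) := fun hA =>
    hD ▸ hA.1.canonicalConn hN hnab.smooth hSZ
  -- The Bianchi formula contains `R_D(V, D_A(SZ))`, whereas `K` expects a second argument of the
  -- form `SW`. As `D_A(SZ)` is vertical for horizontal `A`, `W = S'D_A(SZ)` satisfies `SW =
  -- D_A(SZ)`.
  have hSS : ∀ {A : TangentMfd.VField n M}, TangentMfd.IsHorizontal pN A →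
      TangentMfd.app S (TangentMfd.sPrime S pN (D A (TangentMfd.app S Z)))
        = D A (TangentMfd.app S Z) := by
    intro A hA
    have hv : TangentMfd.app pN (D A (TangentMfd.app S Z)) = 0 := by
      rw [hD, TangentMfd.canonicalConn_horizontal_vertical (funext hA.2)
        (hN.app_app_tangent hS Z), hN.app_app_vertProj]
    calc TangentMfd.app S (TangentMfd.sPrime S pN (D A (TangentMfd.app S Z)))
        = TangentMfd.app (TangentMfd.vertProj pN) (D A (TangentMfd.app S Z)) :=
          funext (hN.tangent_sPrime hS _)
      _ = D A (TangentMfd.app S Z) := by rw [TangentMfd.app_vertProj, hv, sub_zero]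
  -- `r` and `K` are known only on `U`, but they are differentiated at `p`; locality of `D` and
  -- openness of `U` suffice, even if their values are not smooth outside `U`.
  have hcongr : ∀ {A F F' : TangentMfd.VField n M}, TangentMfd.SmoothVField F' →
      (∀ q ∈ U, F q = F' q) → D A F p = D A F' p := fun hF' h =>
    hD ▸ TangentMfd.canonicalConn_congr_right hN _ hF'
      (Filter.eventually_of_mem (hU.mem_nhds hp) h)
  have hcurv : ∀ {A B C : TangentMfd.VField n M}, TangentMfd.SmoothVField A →
      TangentMfd.SmoothVField B → TangentMfd.SmoothVField C →
      TangentMfd.SmoothVField (TangentMfd.curv D A B C) := fun hA hB hC =>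
    hD ▸ hA.curv hN hnab.smooth hB hC
  rw [congrFun (TangentMfd.curv_canonicalConn_eq hS hE hN hnab.smooth hnab.torsion_eq_zero hD
    hX hY hZ rfl) p]
  simp only [TangentMfd.curvExpr, TangentMfd.covDeriv₂, TangentMfd.covDeriv₃, Pi.add_apply,
    Pi.sub_apply]
  rw [hcongr (hcurv hX.1 hY.1 hJ.1) (hr X Y hX hY), hr _ _ (hDh hSZ hX) hY p hp,
    hr _ _ hX (hDh hSZ hY) p hp,
    hcongr (hcurv hY.1 hSZ hJ.1) (hK Y Z _ hY hZ hJ),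
    hcongr (hcurv hX.1 hSZ hJ.1) (hK X Z _ hX hZ hJ),
    hK _ _ _ (hDh hX.1 hY) hZ hJ p hp, hK _ _ _ (hDh hY.1 hX) hZ hJ p hp,
    hK _ _ _ hY (TangentMfd.IsHorizontal.sPrime hS hN (hDS hX)) hJ p hp,
    hK _ _ _ hX (TangentMfd.IsHorizontal.sPrime hS hN (hDS hY)) hJ p hp,
    hK _ _ _ hY hZ (hDh hX.1 hJ) p hp, hK _ _ _ hX hZ (hDh hY.1 hJ) p hp, hSS hX, hSS hY]
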